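/- Let $\mathsf{Pos}$ be the category of posets and monotone maps. All categories below are enriched in $\mathsf{Pos}$: hom-sets are posets and composition is monotone; homs of $\mathsf{Pos}$ are ordered pointwise. Let $\mathsf{DL}$ be the category of bounded distributive lattices and bounded lattice homomorphisms, ordered pointwise; let $\mathsf{DL}_f\subseteq\mathsf{DL}$ be the full subcategory of the finite (equivalently, finitely presentable) distributive lattices, and let $\mathsf{DL}_{\mathit{ff}}\subseteq\mathsf{DL}_f$ be the full subcategory of the distributive lattices that are free on a finite discrete poset, i.e. on a finite set of generators. Let $J'':\mathsf{DL}_{\mathit{ff}}\to\mathsf{DL}_f$ be the inclusion. For locally monotone functors $G:\mathscr D\to\mathscr K$ and $\varphi:\mathscr D^{\mathsf{op}}\to\mathsf{Pos}$, the weighted colimit $\varphi * G$ is an object with an isomorphism of posets $\mathscr K(\varphi * G,X)\cong[\mathscr D^{\mathsf{op}},\mathsf{Pos}](\varphi,\mathscr K(G-,X))$, natural in $X$. The coinserter of a parallel pair $d^0,d^1:X\rightrightarrows Y$ is its colimit weighted by the parallel pair $0,1:\mathbb 1\rightrightarrows\mathbb 2=\{0<1\}$. Explicitly, it is an arrow $c:Y\to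 C$ with $c d^0\le c d^1$ such that every $q:Y\to Z$ with $q d^0\le q d^1$ is $q=hc$ for a unique $h$, and such that $hc\le h'c$ implies $h\le h'$. It is reflexive if there is $i:Y\to X$ with $d^0i=d^1i=\mathrm{id}_Y$. **Theorem.** 1. $J''$ is dense in the $\mathsf{Pos}$-enriched sense: every $A$ in $\mathsf{DL}_f$ is canonically the weighted colimit $\mathsf{DL}_f(J''-,A)*J''$, with unit the identity of $\mathsf{DL}_f(J''-,A)$. 2. The reflexive coinserters in $\mathsf{DL}_f$ form a density presentation of the fully faithful functor $J''$. That is: (a) every reflexive pair in $\mathsf{DL}_f$ has a coinserter in $\mathsf{DL}_f$; (b) these coinserters are $J''$-absolute, i.e. preserved by $\mathsf{DL}_f(J''F,-):\mathsf{DL}_f\to\mathsf{Pos}$ for each $F$ in $\mathsf{DL}_{\mathit{ff}}$; (c) $\mathsf{DL}_f$ is the closure of $\mathsf{DL}_{\mathit{ff}}$ under reflexive coinserters: the smallest class of objects of $\mathsf{DL}_f$ that contains $\mathsf{DL}_{\mathit{ff}}$, is closed under isomorphism, and contains the coinserter of each reflexive pair $X\rightrightarrows Y$ in $\mathsf{DL}_f$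 for which it contains $X$ and $Y$, consists of all finite distributive lattices. -/

import Mathlib

open CategoryTheory

universe u v w w' u' v'

/-! ## Categories enriched in posets -/

/-- A `Pos`-enriched category: a category with partially ordered hom-sets whose composition is
monotone in both arguments. -/
class PosCategory (K : Type u) [Category.{v} K] where
  homOrder : ∀ X Y : K, PartialOrder (X ⟶ Y)
  comp_le_comp : ∀ {X Y Z : K} {f f' : X ⟶ Y} {g g' : Y ⟶ Z},
    f ≤ f' → g ≤ g' → f ≫ g ≤ f' ≫ g'

namespace PosCategory

instance instHomOrder {K : Type u} [Category.{v} K] [PosCategory K] (X Y : K) :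
    PartialOrder (X ⟶ Y) :=
  PosCategory.homOrder X Y

/-- Every ordinary category is `Pos`-enriched with discretely ordered hom-sets. -/
@[reducible]
def discrete (K : Type u) [Category.{v} K] : PosCategory K where
  homOrder X Y :=
    { le := fun f g => f = g
      le_refl := fun _ => rfl
      le_trans := fun _ _ _ h k => h.trans k
      le_antisymm := fun _ _ h _ => h }
  comp_le_comp := by
    intro X Y Z f f' g g' h k
    have h' : f = f' := h
    have k' : g = g' := k
    subst h' k'
    rfl

/-- The opposite `Pos`-category: arrows are reversed, the order on homs is unchanged. -/
instance instOpposite (K : Type u) [Category.{v} K] [PosCategory K] : PosCategory Kᵒᵖ where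
  homOrder X Y := PartialOrder.lift (fun f : X ⟶ Y => f.unop) (fun _ _ h => Quiver.Hom.unop_inj h)
  comp_le_comp h k := comp_le_comp (K := K) k h

/-- A full subcategory carries the order of the ambient category. -/
instance instFullSubcategory {K : Type u} [Category.{v} K] [PosCategory K] (P : ObjectProperty K) :
    PosCategory P.FullSubcategory where
  homOrder X Y :=
    PartialOrder.lift (fun f : X ⟶ Y => f.hom) (fun _ _ h => P.hom_ext h)
  comp_le_comp h k := comp_le_comp (K := K) h k

/-- `Pos` itself: monotone maps are ordered pointwise. -/
instance instPartOrd : PosCategory PartOrd.{u} where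
  homOrder X Y := PartialOrder.lift (fun f : X ⟶ Y => f.hom) (fun _ _ h => PartOrd.hom_ext h)
  comp_le_comp := by
    intro X Y Z f f' g g' h k x
    exact (g.hom.monotone (h x)).trans (k (f'.hom x))

/-- `DL`, the category of bounded distributive lattices: homomorphisms are ordered pointwise. -/
instance instBddDistLat : PosCategory BddDistLat.{u} where
  homOrder X Y := PartialOrder.lift (fun (f : X ⟶ Y) (x : X) => (f x : Y))
    (fun _ _ h => BddDistLat.ext fun x => congrFun h x)
  comp_le_comp := by
    intro X Y Z f f' g g' h k x
    exact (OrderHomClass.mono g.hom (h x)).trans (k (f' x))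

/-- Natural transformations into a `Pos`-category are ordered componentwise. -/
instance instFunctor {D : Type w} [Category.{w'} D] {K : Type u} [Category.{v} K] [PosCategory K] :
    PosCategory (D ⥤ K) where
  homOrder F G := PartialOrder.lift (fun (α : F ⟶ G) (d : D) => α.app d)
    (fun _ _ h => NatTrans.ext h)
  comp_le_comp h k := fun d => comp_le_comp (h d) (k d)

/-- A functor between `Pos`-categories is `Pos`-enriched iff it is locally monotone. -/
class LocallyMonotone {K : Type u} [Category.{v} K] [PosCategory K]
    {L : Type u'} [Category.{v'} L] [PosCategory L] (F : K ⥤ L) : Prop where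
  map_le : ∀ {X Y : K} {f g : X ⟶ Y}, f ≤ g → F.map f ≤ F.map g

section Hom

variable {K : Type u} [Category.{v} K] [PosCategory K]

/-- Postcomposition with `h`, as a monotone map of hom-posets. -/
def postcomp (Z : K) {X Y : K} (h : X ⟶ Y) : (Z ⟶ X) →o (Z ⟶ Y) where
  toFun f := f ≫ h
  monotone' _ _ hf := comp_le_comp hf le_rfl

/-- Precomposition with `h`, as a monotone map of hom-posets. -/
def precomp {X Y : K} (h : X ⟶ Y) (Z : K) : (Y ⟶ Z) →o (X ⟶ Z) where
  toFun f := h ≫ f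
  monotone' _ _ hf := comp_le_comp le_rfl hf

/-- The representable functor `K(Z, -) : K ⥤ Pos`. -/
def homFrom (Z : K) : K ⥤ PartOrd.{v} where
  obj X := PartOrd.of (Z ⟶ X)
  map h := PartOrd.ofHom (postcomp Z h)
  map_id X := by
    ext f
    exact Category.comp_id f
  map_comp h k := by
    ext f
    exact (Category.assoc f h k).symm

/-- The representable functor `K(-, Z) : Kᵒᵖ ⥤ Pos`. -/
def homTo (Z : K) : Kᵒᵖ ⥤ PartOrd.{v} where
  obj X := PartOrd.of (X.unop ⟶ Z)
  map h := PartOrd.ofHom (precomp h.unop Z)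
  map_id X := by
    ext f
    exact Category.id_comp f
  map_comp h k := by
    ext f
    exact Category.assoc k.unop h.unop f

/-- Postcomposition with `h`, as a natural transformation `K(-, X) ⟶ K(-, Y)`. -/
def homToMap {X Y : K} (h : X ⟶ Y) : homTo X ⟶ homTo Y where
  app Z := PartOrd.ofHom (postcomp Z.unop h)
  naturality Z Z' k := by
    ext f
    exact Category.assoc k.unop f h

/-- The action of `F` on homs, as a natural transformation `K(-, X) ⟶ L(F -, F X)`. -/
def homToFunctor {L : Type u'} [Category.{v} L] [PosCategory L] (F : K ⥤ L) [LocallyMonotone F]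
    (X : K) : homTo X ⟶ F.op ⋙ homTo (F.obj X) where
  app Z := PartOrd.ofHom (X := Z.unop ⟶ X) (Y := F.obj Z.unop ⟶ F.obj X)
    { toFun := fun f => F.map f
      monotone' := fun _ _ h => LocallyMonotone.map_le (F := F) h }
  naturality Z Z' k := by
    ext f
    exact F.map_comp k.unop f

instance (Z : K) : LocallyMonotone (homFrom Z) where
  map_le h := fun _ => comp_le_comp le_rfl h

instance (Z : K) : LocallyMonotone (homTo Z) where
  map_le h := fun _ => comp_le_comp h le_rfl

instance {L : Type u'} [Category.{v'} L] [PosCategory L] (F : L ⥤ K) [LocallyMonotone F] :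
    LocallyMonotone F.op where
  map_le h := LocallyMonotone.map_le (F := F) h

instance {L : Type u'} [Category.{v'} L] [PosCategory L] {M : Type w} [Category.{w'} M]
    [PosCategory M] (F : K ⥤ L) (G : L ⥤ M) [LocallyMonotone F] [LocallyMonotone G] :
    LocallyMonotone (F ⋙ G) where
  map_le h := LocallyMonotone.map_le (F := G) (LocallyMonotone.map_le (F := F) h)

end Hom

/-! ## Weighted colimits -/

/-- The data of a weighted colimit in `K`: a diagram `G : D ⥤ K` and a weight `φ : Dᵒᵖ ⥤ Pos`,
both locally monotone. -/
structure WeightedDiagram (K : Type u) [Category.{v} K] [PosCategory K] where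
  Shape : Type w
  [category : Category.{w'} Shape]
  [posCategory : PosCategory Shape]
  diagram : Shape ⥤ K
  weight : Shapeᵒᵖ ⥤ PartOrd.{v}
  [diagramMono : LocallyMonotone diagram]
  [weightMono : LocallyMonotone weight]

attribute [instance] WeightedDiagram.category WeightedDiagram.posCategory
  WeightedDiagram.diagramMono WeightedDiagram.weightMono

namespace WeightedDiagram

variable {K : Type u} [Category.{v} K] [PosCategory K]

/-- The poset `[Dᵒᵖ, Pos](φ, K(G-, X))` of weighted cocones with vertex `X`. -/
abbrev Cocone (W : WeightedDiagram.{u, v, w, w'} K) (X : K) :=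
  W.weight ⟶ W.diagram.op ⋙ homTo X

/-- Compose a weighted cocone with a morphism out of its vertex. -/
def Cocone.extend {W : WeightedDiagram.{u, v, w, w'} K} {X Y : K} (c : W.Cocone X) (h : X ⟶ Y) :
    W.Cocone Y :=
  c ≫ Functor.whiskerLeft W.diagram.op (homToMap h)

/-- The cocone `c` exhibits `L` as the `φ`-weighted colimit `φ * G`: composition with `c` is an
isomorphism of posets `K(L, X) ≅ [Dᵒᵖ, Pos](φ, K(G-, X))` for every `X`. -/
def Cocone.IsColimit {W : WeightedDiagram.{u, v, w, w'} K} {L : K} (c : W.Cocone L) : Prop :=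
  ∀ X : K, ∃ e : (L ⟶ X) ≃o W.Cocone X, ∀ h : L ⟶ X, e h = c.extend h

/-- The image of a weighted diagram under a locally monotone functor. -/
@[reducible]
def map (W : WeightedDiagram.{u, v, w, w'} K) {L : Type u'} [Category.{v} L] [PosCategory L]
    (F : K ⥤ L) [LocallyMonotone F] : WeightedDiagram.{u', v, w, w'} L where
  Shape := W.Shape
  diagram := W.diagram ⋙ F
  weight := W.weight

/-- The image of a weighted cocone under a locally monotone functor. -/
def Cocone.map {W : WeightedDiagram.{u, v, w, w'} K} {X : K} (c : W.Cocone X)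
    {L : Type u'} [Category.{v} L] [PosCategory L] (F : K ⥤ L) [LocallyMonotone F] :
    (W.map F).Cocone (F.obj X) :=
  c ≫ Functor.whiskerLeft W.diagram.op (homToFunctor F X)

end WeightedDiagram

/-- `F` preserves every weighted colimit of `W`. -/
def Preserves {K : Type u} [Category.{v} K] [PosCategory K] {L : Type u'} [Category.{v} L]
    [PosCategory L] (F : K ⥤ L) [LocallyMonotone F] (W : WeightedDiagram.{u, v, w, w'} K) : Prop :=
  ∀ (X : K) (c : W.Cocone X), c.IsColimit → (c.map F).IsColimit

/-! ## Density and density presentations -/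

section Density

variable {A : Type u'} [Category.{v'} A] [PosCategory A] {K : Type u} [Category.{v} K]
  [PosCategory K] (J : A ⥤ K) [LocallyMonotone J]

/-- The diagram `J` weighted by `K(J-, X)`. -/
@[reducible]
def canonicalDiagram (X : K) : WeightedDiagram.{u, v, u', v'} K where
  Shape := A
  diagram := J
  weight := J.op ⋙ homTo X

/-- The canonical cocone, given by the identity of `K(J-, X)`. -/
def canonicalCocone (X : K) : (canonicalDiagram J X).Cocone X :=
  𝟙 (J.op ⋙ homTo X)

/-- `J` is dense (in the `Pos`-enriched sense): every object `X` is the canonical weighted colimit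
`K(J-, X) * J`; that is, the identity of `K` is the left Kan extension of `J` along itself. -/
def IsDense : Prop :=
  ∀ X : K, (canonicalCocone J X).IsColimit

/-- The weighted diagram `W` in `K` has `J`-absolute colimits: they are preserved by the functors
`K(J a, -) : K ⥤ Pos`. -/
def IsAbsolute (W : WeightedDiagram.{u, v, w, w'} K) : Prop :=
  ∀ a : A, Preserves (homFrom (J.obj a)) W

variable {ι : Type*} (Φ : ι → WeightedDiagram.{u, v, w, w'} K)

/-- The closure of (the image of) `J` under the colimits of the family `Φ`: the objects of the
smallest replete full subcategory of `K` which contains every `J a` and which contains a colimit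
of a member of `Φ` as soon as it contains all objects of the diagram. -/
inductive ColimitClosure : K → Prop
  | of (a : A) : ColimitClosure (J.obj a)
  | of_iso {X Y : K} (e : X ≅ Y) : ColimitClosure X → ColimitClosure Y
  | of_isColimit (i : ι) (L : K) (c : (Φ i).Cocone L) (hc : c.IsColimit)
      (h : ∀ d : (Φ i).Shape, ColimitClosure ((Φ i).diagram.obj d)) : ColimitClosure L

/-- The family `Φ` is a density presentation of the fully faithful functor `J`. -/
structure IsDensityPresentation : Prop where
  /-- `J` is fully faithful as a `Pos`-enriched functor. -/
  fullyFaithful : ∀ a b : A, ∃ e : (a ⟶ b) ≃o (J.obj a ⟶ J.obj b), ∀ f, e f = J.map f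
  /-- All colimits of the family exist in `K`. -/
  exists_colimit : ∀ i, ∃ (L : K) (c : (Φ i).Cocone L), c.IsColimit
  /-- All colimits of the family are `J`-absolute. -/
  absolute : ∀ i, IsAbsolute J (Φ i)
  /-- `K` is the closure of `A` under the colimits of the family. -/
  closure : ∀ X : K, ColimitClosure J Φ X

end Density

/-! ## Reflexive coinserters -/

open Limits

instance instWalkingParallelPair : PosCategory WalkingParallelPair :=
  discrete WalkingParallelPair

lemma locallyMonotone_of_parallelPair {L : Type u'} [Category.{v'} L] [PosCategory L]
    (F : WalkingParallelPair ⥤ L) : LocallyMonotone F where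
  map_le := by
    intro X Y f g h
    have h' : f = g := h
    rw [h']

lemma locallyMonotone_of_parallelPair_op {L : Type u'} [Category.{v'} L] [PosCategory L]
    (F : WalkingParallelPairᵒᵖ ⥤ L) : LocallyMonotone F where
  map_le := by
    intro X Y f g h
    have h' : f = g := Quiver.Hom.unop_inj h
    rw [h']

/-- The two-element chain `𝟚 = {0 < 1}`. -/
abbrev Two : PartOrd.{v} := PartOrd.of (ULift.{v} (Fin 2))

/-- The one-element poset `𝟙`. -/
abbrev One : PartOrd.{v} := PartOrd.of PUnit.{v + 1}

/-- The values of the coinserter weight on objects: the source `zero` of the parallel pair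
goes to `𝟚`, its target `one` goes to `𝟙`. -/
def coinserterWeightObj : WalkingParallelPair → PartOrd.{v}
  | .zero => Two
  | .one => One

/-- The values of the coinserter weight on arrows: the first arrow of the parallel pair goes to
`0 : 𝟙 ⟶ 𝟚` and the second one to `1 : 𝟙 ⟶ 𝟚`. -/
def coinserterWeightMap : ∀ {X Y : WalkingParallelPair}, (X ⟶ Y) →
    (coinserterWeightObj.{v} Y ⟶ coinserterWeightObj.{v} X)
  | _, _, .left => PartOrd.ofHom (X := PUnit.{v + 1}) (Y := ULift.{v} (Fin 2))
      (OrderHom.const _ ⟨0⟩)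
  | _, _, .right => PartOrd.ofHom (X := PUnit.{v + 1}) (Y := ULift.{v} (Fin 2))
      (OrderHom.const _ ⟨1⟩)
  | _, _, .id X => 𝟙 (coinserterWeightObj X)

lemma coinserterWeightMap_comp : ∀ {X Y Z : WalkingParallelPair} (f : WalkingParallelPairHom X Y)
    (g : WalkingParallelPairHom Y Z), coinserterWeightMap.{v} (f.comp g) =
      coinserterWeightMap.{v} (X := Y) (Y := Z) g ≫ coinserterWeightMap.{v} (X := X) (Y := Y) f
  | _, _, _, .left, .id _ => rfl
  | _, _, _, .right, .id _ => rfl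
  | _, _, _, .id _, _ => rfl

/-- The weight of coinserters. -/
def coinserterWeight : WalkingParallelPairᵒᵖ ⥤ PartOrd.{v} where
  obj X := coinserterWeightObj X.unop
  map f := coinserterWeightMap f.unop
  map_id _ := rfl
  map_comp := by
    intro X Y Z f g
    exact coinserterWeightMap_comp g.unop f.unop

section Coinserter

variable {K : Type u} [Category.{v} K] [PosCategory K]

/-- The coinserter of `d⁰, d¹ : X ⟶ Y`, as the colimit of the parallel pair weighted by
`coinserterWeight`. -/
@[reducible]
def coinserterDiagram {X Y : K} (d0 d1 : X ⟶ Y) : WeightedDiagram.{u, v, 0, 0} K where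
  Shape := WalkingParallelPair
  diagram := parallelPair d0 d1
  weight := coinserterWeight
  diagramMono := locallyMonotone_of_parallelPair _
  weightMono := locallyMonotone_of_parallelPair_op _

variable (K) in
/-- A reflexive pair: parallel arrows with a common right inverse. -/
structure ReflexivePair where
  {X Y : K}
  (d0 d1 : X ⟶ Y)
  exists_section : ∃ i : Y ⟶ X, i ≫ d0 = 𝟙 Y ∧ i ≫ d1 = 𝟙 Y

variable (K) in
/-- The family of all reflexive coinserters in `K`. -/
@[reducible]
def reflexiveCoinserters (p : ReflexivePair K) : WeightedDiagram.{u, v, 0, 0} K :=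
  coinserterDiagram p.d0 p.d1

end Coinserter

end PosCategory

/-! ## Finite distributive lattices and free ones on finite discrete posets -/

open PosCategory

/-- A bounded distributive lattice is finite. -/
def isFiniteDL : ObjectProperty BddDistLat.{u} :=
  fun A => Finite A

/-- A bounded distributive lattice is free on a finite discrete poset, that is, on a finite set
of generators. -/
def isDiscretelyFinitelyFree : ObjectProperty BddDistLat.{u} :=
  fun A => ∃ (n : ℕ) (η : Fin n → A), ∀ (B : BddDistLat.{u}) (f : Fin n → B),
    ∃! h : A ⟶ B, ∀ i, h (η i) = f i

lemma isDiscretelyFinitelyFree_le : isDiscretelyFinitelyFree.{u} ≤ isFiniteDL.{u} := by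
  rintro A ⟨n, η, hη⟩
  let s : Set A := Set.range η ∪ {⊥, ⊤}
  have hs : (latticeClosure s).Finite := ((Set.finite_range η).union (by simp)).latticeClosure
  have hsub : s ⊆ latticeClosure s := subset_latticeClosure
  have hl : IsSublattice (latticeClosure s) := isSublattice_latticeClosure
  let S : Sublattice A := ⟨latticeClosure s, hl.supClosed, hl.infClosed⟩
  have hbot : ⊥ ∈ S := hsub (by simp [s])
  have htop : ⊤ ∈ S := hsub (by simp [s])
  let _ : BoundedOrder S :=
    { bot := ⟨⊥, hbot⟩, top := ⟨⊤, htop⟩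
      bot_le := fun x => (bot_le : (⊥ : A) ≤ x.1)
      le_top := fun x => (le_top : x.1 ≤ (⊤ : A)) }
  let incl : BddDistLat.of S ⟶ A := BddDistLat.ofHom
    { toFun := fun x => x.1
      map_sup' := fun _ _ => rfl
      map_inf' := fun _ _ => rfl
      map_top' := rfl
      map_bot' := rfl }
  obtain ⟨h, hh, -⟩ := hη (BddDistLat.of S) (fun i => ⟨η i, hsub (by simp [s])⟩)
  have hid : h ≫ incl = 𝟙 A :=
    (hη A η).unique (fun i => by rw [BddDistLat.comp_apply, hh]; rfl) (fun i => by simp)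
  have hall : ∀ a : A, a ∈ latticeClosure s := fun a => by
    have ha : incl (h a) = a := by rw [← BddDistLat.comp_apply, hid, BddDistLat.id_apply]
    rw [← ha]
    exact (h a).2
  exact Set.finite_univ_iff.mp (hs.subset fun a _ => hall a)

/-- `DL_f`: the full subcategory of `DL` on the finite lattices. -/
abbrev DLf := isFiniteDL.{u}.FullSubcategory

/-- `DL_ff`: the full subcategory of `DL` on the lattices free on finite discrete posets. -/
abbrev DLff := isDiscretelyFinitelyFree.{u}.FullSubcategory

/-- The inclusion `DL_ff ⥤ DL_f`. -/
abbrev inclDLff : DLff.{u} ⥤ DLf.{u} :=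
  ObjectProperty.ιOfLE isDiscretelyFinitelyFree_le

instance : LocallyMonotone inclDLff.{u} where
  map_le h := h

/-! ## Bounded distributive lattices -/

namespace BddDistLat

/-! The point is that reflexive coinserters of distributive lattices are computed as in posets, and
that maps out of a finitely generated free lattice form a finite power of the target.

For a pair `d0, d1 : X ⟶ Y`, let `a` step to `b` if `a ≤ d0 x` and `d1 x ≤ b` for some `x`. The
steps are closed under joins and meets because `d0` and `d1` are homomorphisms, and they are
reflexive because the pair is. So their transitive closure is a preorder compatible with the
operations, and its quotient is the coinserter (`exists_isStepQuotient`). Any other coinserter has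
the same description (`isStepQuotient_of_isColimit`).

Absoluteness: if `F` is free on `n` generators, homs from `F` are `n`-tuples, ordered coordinatewise
(`IsFree.le_of_le`). Surjections lift along `F`, and chains of steps in the coordinates combine into
one chain of steps between tuples (`reflTransGen_pi`).

Closure and density both use the surjection `counit A` from the free lattice on the elements of `A`.
Its kernel preorder is finite, hence indexes the generators of a free lattice, which presents `A` as
a reflexive coinserter of free lattices. A weighted cocone on the canonical diagram is determined by
its value at `counit A`, since every map from a free lattice to `A` factors through it. -/

/-- The quotient by a setoid, as a type without inherited order. -/
def OrderQuotient {α : Type u} (S : Setoid α) : Type u :=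
  _root_.Quotient S

/-- A preorder on a bounded distributive lattice which extends the lattice order and is compatible
with the lattice operations is the kernel preorder of a surjective homomorphism. -/
lemma exists_quotient (Y : BddDistLat.{u}) (r : Y → Y → Prop) (hle : ∀ a b, a ≤ b → r a b)
    (htrans : ∀ a b c, r a b → r b c → r a c)
    (hsup : ∀ a b c, r a c → r b c → r (a ⊔ b) c)
    (hinf : ∀ a b c, r c a → r c b → r c (a ⊓ b)) :
    ∃ (Q : BddDistLat.{u}) (p : Y ⟶ Q), Function.Surjective p ∧ ∀ a b, p a ≤ p b ↔ r a b := by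
  let S : Setoid Y :=
    { r := fun a b => r a b ∧ r b a
      iseqv :=
        { refl := fun a => ⟨hle a a le_rfl, hle a a le_rfl⟩
          symm := fun h => ⟨h.2, h.1⟩
          trans := fun h k => ⟨htrans _ _ _ h.1 k.1, htrans _ _ _ k.2 h.2⟩ } }
  let P : PartialOrder (OrderQuotient S) :=
    { le := Quotient.lift₂ r fun a b a' b' h k => propext
        ⟨fun l => htrans _ _ _ h.2 (htrans _ _ _ l k.1),
          fun l => htrans _ _ _ h.1 (htrans _ _ _ l k.2)⟩
      le_refl := by
        rintro ⟨a⟩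
        exact hle a a le_rfl
      le_trans := by
        rintro ⟨a⟩ ⟨b⟩ ⟨c⟩ h k
        exact htrans a b c h k
      le_antisymm := by
        rintro ⟨a⟩ ⟨b⟩ h k
        exact Quotient.sound ⟨h, k⟩ }
  have hsup' : ∀ a b a' b', r a a' → r b b' → r (a ⊔ b) (a' ⊔ b') := fun a b a' b' h k =>
    hsup _ _ _ (htrans _ _ _ h (hle _ _ le_sup_left)) (htrans _ _ _ k (hle _ _ le_sup_right))
  have hinf' : ∀ a b a' b', r a a' → r b b' → r (a ⊓ b) (a' ⊓ b') := fun a b a' b' h k =>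
    hinf _ _ _ (htrans _ _ _ (hle _ _ inf_le_left) h) (htrans _ _ _ (hle _ _ inf_le_right) k)
  let Lt : Lattice (OrderQuotient S) :=
    { P with
      sup := Quotient.map₂ (· ⊔ ·) fun a a' h b b' k =>
        ⟨hsup' _ _ _ _ h.1 k.1, hsup' _ _ _ _ h.2 k.2⟩
      inf := Quotient.map₂ (· ⊓ ·) fun a a' h b b' k =>
        ⟨hinf' _ _ _ _ h.1 k.1, hinf' _ _ _ _ h.2 k.2⟩
      le_sup_left := by
        rintro ⟨a⟩ ⟨b⟩
        exact hle _ _ le_sup_left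
      le_sup_right := by
        rintro ⟨a⟩ ⟨b⟩
        exact hle _ _ le_sup_right
      sup_le := by
        rintro ⟨a⟩ ⟨b⟩ ⟨c⟩
        exact hsup a b c
      inf_le_left := by
        rintro ⟨a⟩ ⟨b⟩
        exact hle _ _ inf_le_left
      inf_le_right := by
        rintro ⟨a⟩ ⟨b⟩
        exact hle _ _ inf_le_right
      le_inf := by
        rintro ⟨a⟩ ⟨b⟩ ⟨c⟩
        exact hinf b c a }
  let D : DistribLattice (OrderQuotient S) :=
    { Lt with
      le_sup_inf := by
        rintro ⟨a⟩ ⟨b⟩ ⟨c⟩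
        exact hle _ _ le_sup_inf }
  let B : BoundedOrder (OrderQuotient S) :=
    { bot := Quotient.mk S ⊥
      top := Quotient.mk S ⊤
      bot_le := by
        rintro ⟨a⟩
        exact hle _ _ bot_le
      le_top := by
        rintro ⟨a⟩
        exact hle _ _ le_top }
  let p : BoundedLatticeHom Y (OrderQuotient S) :=
    { toFun := Quotient.mk S
      map_sup' := fun _ _ => rfl
      map_inf' := fun _ _ => rfl
      map_top' := rfl
      map_bot' := rfl }
  exact ⟨of (OrderQuotient S), ofHom (X := Y) p, Quotient.mk_surjective, fun a b => Iff.rfl⟩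

lemma hom_mono {X Y : BddDistLat.{u}} (f : X ⟶ Y) {a b : X} (h : a ≤ b) : f a ≤ f b :=
  OrderHomClass.mono f.hom h

/-- A homomorphism factors through a surjective one as soon as it is monotone for its kernel
preorder. -/
lemma exists_factor {Y A Z : BddDistLat.{u}} (p : Y ⟶ A) (hp : Function.Surjective p)
    (q : Y ⟶ Z) (hq : ∀ a b, p a ≤ p b → q a ≤ q b) : ∃ h : A ⟶ Z, p ≫ h = q := by
  obtain ⟨s, hs⟩ := hp.hasRightInverse
  -- The section `s` is only a function; since `q` is constant on the fibres of `p`, the choice is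
  -- harmless and `q ∘ s` preserves the operations.
  have key : ∀ a b, p a = p b → q a = q b := fun a b h =>
    le_antisymm (hq _ _ h.le) (hq _ _ h.ge)
  let h : BoundedLatticeHom A Z :=
    { toFun := fun a => q (s a)
      map_sup' := fun a b => by
        rw [← map_sup q.hom]
        exact key _ _ (by rw [hs, map_sup p.hom, hs, hs])
      map_inf' := fun a b => by
        rw [← map_inf q.hom]
        exact key _ _ (by rw [hs, map_inf p.hom, hs, hs])
      map_top' := by
        rw [← map_top q.hom]
        exact key _ _ (by rw [hs, map_top p.hom])
      map_bot' := by
        rw [← map_bot q.hom]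
        exact key _ _ (by rw [hs, map_bot p.hom]) }
  exact ⟨ofHom (X := A) (Y := Z) h, ext fun y => key _ _ (hs (p y))⟩

/-! ### Universal property of free lattices and its order-enriched form -/

/-- `η : ι → F` exhibits `F` as a free bounded distributive lattice. -/
def IsFree {ι : Type w} {F : BddDistLat.{u}} (η : ι → F) : Prop :=
  ∀ (B : BddDistLat.{u}) (f : ι → B), ∃! h : F ⟶ B, ∀ i, h (η i) = f i

namespace IsFree

variable {ι : Type w} {F : BddDistLat.{u}} {η : ι → F} (hη : IsFree η)

/-- The homomorphism determined by its values on the generators. -/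
noncomputable def lift {B : BddDistLat.{u}} (f : ι → B) : F ⟶ B :=
  (hη B f).choose

lemma lift_apply {B : BddDistLat.{u}} (f : ι → B) (i : ι) : hη.lift f (η i) = f i :=
  (hη B f).choose_spec.1 i

lemma hom_ext (hη : IsFree η) {B : BddDistLat.{u}} {f g : F ⟶ B} (h : ∀ i, f (η i) = g (η i)) :
    f = g :=
  (hη B fun i => g (η i)).unique h fun _ => rfl

/-- A property which holds for the generators and is stable under the lattice operations holds
everywhere. -/
lemma induction (hη : IsFree η) {p : F → Prop} (hgen : ∀ i, p (η i)) (hbot : p ⊥) (htop : p ⊤)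
    (hsup : ∀ a b, p a → p b → p (a ⊔ b)) (hinf : ∀ a b, p a → p b → p (a ⊓ b)) (a : F) : p a := by
  let _ : DistribLattice {a // p a} :=
    { Subtype.lattice (fun {a b} => hsup a b) (fun {a b} => hinf a b) with
      le_sup_inf := fun a b c => (le_sup_inf : (a.1 ⊔ b.1) ⊓ (a.1 ⊔ c.1) ≤ a.1 ⊔ b.1 ⊓ c.1) }
  let _ : BoundedOrder {a // p a} := Subtype.boundedOrder hbot htop
  let incl : of {a // p a} ⟶ F := ofHom (Y := F)
    { toFun := fun x => x.1
      map_sup' := fun _ _ => rfl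
      map_inf' := fun _ _ => rfl
      map_top' := rfl
      map_bot' := rfl }
  let h : F ⟶ of {a // p a} := hη.lift fun i => ⟨η i, hgen i⟩
  -- The elements satisfying `p` form a bounded sublattice; the lift into it followed by the
  -- inclusion fixes the generators, so the sublattice is everything.
  have hid : h ≫ incl = 𝟙 F := hη.hom_ext fun i => by
    rw [comp_apply, hη.lift_apply]
    rfl
  have ha : incl (h a) = a := by rw [← comp_apply, hid, id_apply]
  rw [← ha]
  exact (h a).2

/-- The elements where `f ≤ g` are closed under the lattice operations. This upgrades the universal
property from sets to posets, as enrichment requires. -/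
lemma le_of_le (hη : IsFree η) {B : BddDistLat.{u}} {f g : F ⟶ B}
    (h : ∀ i, f (η i) ≤ g (η i)) : f ≤ g := fun a =>
  hη.induction (p := fun a => f a ≤ g a) h
    ((map_bot f.hom).trans_le bot_le) (le_top.trans_eq (map_top g.hom).symm)
    (fun a b ha hb => by
      have := sup_le_sup ha hb
      rwa [← map_sup f.hom, ← map_sup g.hom] at this)
    (fun a b ha hb => by
      have := inf_le_inf ha hb
      rwa [← map_inf f.hom, ← map_inf g.hom] at this) a

end IsFree

/-! ### The free bounded distributive lattice on a finite set -/

section Free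

variable (ι : Type u)

/-- The free bounded distributive lattice on a finite set `ι`: the lattice of families of finite
subsets of `ι` which are stable under enlargement. -/
abbrev free : BddDistLat.{u} :=
  of (LowerSet (Finset ι)ᵒᵈ)

variable {ι}

/-- The generators of the free bounded distributive lattice. -/
def freeGen (i : ι) : free ι where
  carrier := {s | i ∈ OrderDual.ofDual s}
  lower' _ _ h hi := h hi

/-- Finite meets of generators are the principal families; they are the building blocks of the
normal form below. -/
lemma mem_finsetInf_freeGen (s : Finset ι) (t : (Finset ι)ᵒᵈ) :
    t ∈ (s.inf freeGen : LowerSet (Finset ι)ᵒᵈ) ↔ s ⊆ OrderDual.ofDual t := by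
  classical
  induction s using Finset.induction_on with
  | empty => simp
  | insert i s _ ih =>
    rw [Finset.inf_insert, LowerSet.mem_inf_iff, ih, Finset.insert_subset_iff]
    rfl

variable [Finite ι]

instance : Finite (free ι) :=
  Finite.of_injective (fun s : LowerSet (Finset ι)ᵒᵈ => (s : Set (Finset ι)ᵒᵈ))
    SetLike.coe_injective

open Classical in
-- Disjunctive normal form: each family is the join, over its members `t`, of the meet of the
-- generators in `t`. This forces the formula for the lift, and distributivity makes the formula a
-- homomorphism.
lemma isFree_freeGen : IsFree (freeGen (ι := ι)) := by
  have := Fintype.ofFinite ι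
  intro B f
  let mem (s : free ι) : Finset (Finset ι) := Finset.univ.filter fun t => OrderDual.toDual t ∈ s
  have hmem : ∀ (s : free ι) (t : Finset ι), t ∈ mem s ↔ OrderDual.toDual t ∈ s := by simp [mem]
  have hle : ∀ (s : free ι) (t : Finset ι), OrderDual.toDual t ∈ s →
      t.inf f ≤ (mem s).sup fun t => t.inf f := fun s t ht =>
    Finset.le_sup (f := fun t => t.inf f) ((hmem s t).2 ht)
  let h : BoundedLatticeHom (free ι) B :=
    { toFun := fun s => (mem s).sup fun t => t.inf f
      map_sup' := fun s s' => by
        rw [← Finset.sup_union]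
        congr 1
        ext t
        rw [Finset.mem_union, hmem, hmem, hmem]
        rfl
      map_inf' := fun s s' => by
        apply le_antisymm
        · refine Finset.sup_le fun t ht => ?_
          rw [hmem] at ht
          exact le_inf (hle s t ht.1) (hle s' t ht.2)
        · rw [Finset.sup_inf_distrib_right]
          refine Finset.sup_le fun t ht => ?_
          rw [Finset.sup_inf_distrib_left]
          refine Finset.sup_le fun t' ht' => ?_
          rw [hmem] at ht ht'
          rw [← Finset.inf_union]
          -- Both families are stable under enlargement, so the union of a member of each lies in
          -- both.
          exact hle (s ⊓ s') (t ∪ t') ⟨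
            s.lower (OrderDual.toDual_le_toDual.2 Finset.subset_union_left) ht,
            s'.lower (OrderDual.toDual_le_toDual.2 Finset.subset_union_right) ht'⟩
      map_top' := top_unique <| by
        simpa using hle ⊤ ∅ trivial
      map_bot' := bot_unique <| Finset.sup_le fun t ht => ((hmem ⊥ t).1 ht).elim }
  refine ⟨ofHom h, fun i => ?_, fun k hk => ?_⟩
  · apply le_antisymm
    · refine Finset.sup_le fun t ht => ?_
      exact Finset.inf_le ((hmem (freeGen i) t).1 ht)
    · have := hle (freeGen i) {i} (Finset.mem_singleton_self i)
      rwa [Finset.inf_singleton] at this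
  · ext s
    -- Uniqueness: a homomorphism is determined by its values on the normal form.
    have hs : s = (mem s).sup fun t => (t.inf freeGen : LowerSet (Finset ι)ᵒᵈ) := by
      apply le_antisymm
      · intro t ht
        have : (OrderDual.ofDual t).inf freeGen ≤
            (mem s).sup fun t => (t.inf freeGen : LowerSet (Finset ι)ᵒᵈ) :=
          Finset.le_sup (f := fun t => (t.inf freeGen : LowerSet (Finset ι)ᵒᵈ))
            ((hmem s (OrderDual.ofDual t)).2 ht)
        exact this ((mem_finsetInf_freeGen _ _).2 subset_rfl)
      · refine Finset.sup_le fun t ht t' ht' => ?_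
        exact s.lower ((mem_finsetInf_freeGen _ _).1 ht') ((hmem s t).1 ht)
    conv_lhs => rw [hs]
    refine (map_finset_sup k.hom (mem s) _).trans ?_
    refine Finset.sup_congr rfl fun t _ => ?_
    refine (map_finset_inf k.hom t _).trans ?_
    exact Finset.inf_congr rfl fun i _ => hk i

lemma isDiscretelyFinitelyFree_free : isDiscretelyFinitelyFree (free ι) := by
  obtain ⟨n, ⟨e⟩⟩ := Finite.exists_equiv_fin ι
  refine ⟨n, freeGen ∘ e.symm, fun B f => ?_⟩
  obtain ⟨h, hh, huniq⟩ := isFree_freeGen B (f ∘ e)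
  exact ⟨h, fun i => (hh _).trans (congrArg f (e.apply_symm_apply i)), fun k hk =>
    huniq k fun i => by simpa using hk (e i)⟩

end Free

end BddDistLat

/-! ## Weighted colimits and coinserters -/

namespace PosCategory

open Limits Opposite

section

variable {K : Type u} [Category.{v} K] [PosCategory K]

/-- Extension along `c` is always monotone, so reflecting the order and being surjective suffice;
injectivity follows by antisymmetry. -/
lemma WeightedDiagram.Cocone.isColimit_iff {W : WeightedDiagram.{u, v, w, w'} K} {L : K}
    (c : W.Cocone L) : c.IsColimit ↔ ∀ X : K,
      (∀ h h' : L ⟶ X, c.extend h ≤ c.extend h' → h ≤ h') ∧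
        ∀ d : W.Cocone X, ∃ h : L ⟶ X, c.extend h = d := by
  refine forall_congr' fun X => ⟨?_, ?_⟩
  · rintro ⟨e, he⟩
    refine ⟨fun h h' hh => ?_, fun d => ⟨e.symm d, ?_⟩⟩
    · rwa [← he, ← he, e.le_iff_le] at hh
    · rw [← he, e.apply_symm_apply]
  · rintro ⟨hle, hsurj⟩
    have hle' : ∀ h h' : L ⟶ X, c.extend h ≤ c.extend h' ↔ h ≤ h' := fun h h' =>
      ⟨hle h h', fun hh d x => comp_le_comp le_rfl hh⟩
    let f : (L ⟶ X) ↪o W.Cocone X := OrderEmbedding.ofMapLEIff c.extend hle'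
    exact ⟨RelIso.ofSurjective f hsurj, fun h => rfl⟩

/-- The diagram for the coinserter of the two arrows in the image of `D`. -/
@[reducible]
def coinserterDiagramOf (D : WalkingParallelPair ⥤ K) : WeightedDiagram.{u, v, 0, 0} K where
  Shape := WalkingParallelPair
  diagram := D
  weight := coinserterWeight
  diagramMono := locallyMonotone_of_parallelPair _
  weightMono := locallyMonotone_of_parallelPair_op _

open WalkingParallelPair WalkingParallelPairHom

variable {D : WalkingParallelPair ⥤ K}

/-- The arrow out of the target of the parallel pair which is given by a coinserter cocone. -/
def coinserterLeg {X : K} (c : (coinserterDiagramOf D).Cocone X) : D.obj one ⟶ X :=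
  (c.app (op one)).hom PUnit.unit

lemma app_left_eq {X : K} (c : (coinserterDiagramOf D).Cocone X) :
    (c.app (op zero)).hom ⟨0⟩ = D.map left ≫ coinserterLeg c :=
  congrArg (fun k : One ⟶ PartOrd.of (D.obj zero ⟶ X) => k.hom PUnit.unit)
    (c.naturality (Quiver.Hom.op (X := zero) (Y := one) left))

lemma app_right_eq {X : K} (c : (coinserterDiagramOf D).Cocone X) :
    (c.app (op zero)).hom ⟨1⟩ = D.map right ≫ coinserterLeg c :=
  congrArg (fun k : One ⟶ PartOrd.of (D.obj zero ⟶ X) => k.hom PUnit.unit)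
    (c.naturality (Quiver.Hom.op (X := zero) (Y := one) right))

lemma coinserterLeg_condition {X : K} (c : (coinserterDiagramOf D).Cocone X) :
    D.map left ≫ coinserterLeg c ≤ D.map right ≫ coinserterLeg c := by
  rw [← app_left_eq, ← app_right_eq]
  exact (c.app (op zero)).hom.monotone (show (0 : Fin 2) ≤ 1 by decide)

/-- By naturality the two values of the component at `zero` are the composites of the leg with the
two arrows. -/
lemma le_of_coinserterLeg_le {X : K} {c c' : (coinserterDiagramOf D).Cocone X}
    (h : coinserterLeg c ≤ coinserterLeg c') : c ≤ c' := by
  rintro ⟨_ | _⟩ ⟨x⟩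
  · fin_cases x
    · exact (app_left_eq c).trans_le ((comp_le_comp le_rfl h).trans_eq (app_left_eq c').symm)
    · exact (app_right_eq c).trans_le ((comp_le_comp le_rfl h).trans_eq (app_right_eq c').symm)
  · exact h

lemma coinserterLeg_injective {X : K} {c c' : (coinserterDiagramOf D).Cocone X}
    (h : coinserterLeg c = coinserterLeg c') : c = c' :=
  le_antisymm (le_of_coinserterLeg_le h.le) (le_of_coinserterLeg_le h.ge)

/-- The components of the cocone given by `q`. -/
def coinserterCoconeApp {X : K} (q : D.obj one ⟶ X) (hq : D.map left ≫ q ≤ D.map right ≫ q) :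
    ∀ d : WalkingParallelPair, coinserterWeightObj d ⟶ PartOrd.of (D.obj d ⟶ X)
  | zero => PartOrd.ofHom (X := ULift.{v} (Fin 2)) (Y := D.obj zero ⟶ X)
      { toFun := fun i => if i.down = 0 then D.map left ≫ q else D.map right ≫ q
        monotone' := by
          rintro ⟨i⟩ ⟨j⟩ (hij : i ≤ j)
          fin_cases i <;> fin_cases j
          · exact le_rfl
          · exact hq
          · exact absurd hij (by decide)
          · exact le_rfl }
  | one => PartOrd.ofHom (X := PUnit.{v + 1}) (Y := D.obj one ⟶ X) (OrderHom.const _ q)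

/-- The coinserter cocone given by `q`. -/
def coinserterCocone {X : K} (q : D.obj one ⟶ X) (hq : D.map left ≫ q ≤ D.map right ≫ q) :
    (coinserterDiagramOf D).Cocone X where
  app d := coinserterCoconeApp q hq d.unop
  naturality := by
    rintro ⟨d⟩ ⟨d'⟩ ⟨f⟩
    change WalkingParallelPairHom d' d at f
    cases f with
    | left => rfl
    | right => rfl
    | id d =>
      refine ((coinserterDiagramOf D).weight.map_id (op d) ▸ Category.id_comp _).trans ?_
      exact (((coinserterDiagramOf D).diagram.op ⋙ homTo X).map_id (op d) ▸
        (Category.comp_id _)).symm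

/-- The elementary form of the universal property. It allows any `D`, so that it also applies to the
image of a parallel pair under a hom-functor. -/
lemma isColimit_coinserter_iff {L : K} (c : (coinserterDiagramOf D).Cocone L) :
    c.IsColimit ↔ ∀ X : K,
      (∀ h h' : L ⟶ X, coinserterLeg c ≫ h ≤ coinserterLeg c ≫ h' → h ≤ h') ∧
        ∀ q : D.obj one ⟶ X, D.map left ≫ q ≤ D.map right ≫ q →
          ∃ h : L ⟶ X, coinserterLeg c ≫ h = q := by
  rw [c.isColimit_iff]
  refine forall_congr' fun X => and_congr (forall₂_congr fun h h' => ?_) ⟨fun H q hq => ?_,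
    fun H d => ?_⟩
  · exact imp_congr_left ⟨fun hh => hh (op one) PUnit.unit,
      le_of_coinserterLeg_le (c := c.extend h) (c' := c.extend h')⟩
  · obtain ⟨h, hh⟩ := H (coinserterCocone q hq)
    exact ⟨h, congrArg coinserterLeg hh⟩
  · obtain ⟨h, hh⟩ := H (coinserterLeg d) (coinserterLeg_condition d)
    exact ⟨h, coinserterLeg_injective hh⟩

end

/-! ### Coinserters of posets -/

/-- One step of the preorder generated by the inequalities `d⁰ x ≤ d¹ x`. -/
def CoinserterStep {α : Type u} {β : Type v} [LE β] (d0 d1 : α → β) (a b : β) : Prop :=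
  ∃ x, a ≤ d0 x ∧ d1 x ≤ b

/-- A surjection onto the quotient by the preorder generated by the inequalities `d⁰ x ≤ d¹ x` is
a coinserter of posets. -/
lemma isColimit_coinserter_partOrd {D : WalkingParallelPair ⥤ PartOrd.{u}} {L : PartOrd.{u}}
    (c : (coinserterDiagramOf D).Cocone L) (hsurj : Function.Surjective (coinserterLeg c).hom)
    (hle : ∀ a b, (coinserterLeg c).hom a ≤ (coinserterLeg c).hom b → Relation.ReflTransGen
      (CoinserterStep (D.map .left).hom (D.map .right).hom) a b) : c.IsColimit := by
  rw [isColimit_coinserter_iff]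
  refine fun X => ⟨fun h h' hh => ?_, fun q hq => ?_⟩
  · intro y
    obtain ⟨x, rfl⟩ := hsurj y
    exact hh x
  · have key : ∀ a b, (coinserterLeg c).hom a ≤ (coinserterLeg c).hom b → q.hom a ≤ q.hom b := by
      intro a b hab
      have hr := hle a b hab
      clear hab
      induction hr with
      | refl => exact le_rfl
      | tail _ hs ih =>
        obtain ⟨x, h0, h1⟩ := hs
        exact ih.trans ((q.hom.monotone h0).trans ((hq x).trans (q.hom.monotone h1)))
    obtain ⟨s, hs⟩ := hsurj.hasRightInverse
    refine ⟨PartOrd.ofHom (X := L) (Y := X) ⟨fun y => q.hom (s y), fun a b hab => ?_⟩, ?_⟩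
    · apply key
      rwa [hs, hs]
    · ext a
      exact le_antisymm (key _ _ (hs _).le) (key _ _ (hs _).ge)

end PosCategory

/-! ## Reflexive coinserters of finite distributive lattices -/

open Limits Opposite BddDistLat Relation

/-- The coordinates are moved one at a time, the others staying put by reflexivity; finiteness makes
the total chain finite. -/
lemma reflTransGen_pi {ι : Type w} [Finite ι] {β : Type v} {R : β → β → Prop} (hR : ∀ b, R b b)
    {a b : ι → β} (h : ∀ i, ReflTransGen R (a i) (b i)) :
    ReflTransGen (fun f g : ι → β => ∀ i, R (f i) (g i)) a b := by
  classical
  have := Fintype.ofFinite ι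
  have step : ∀ (f : ι → β) (i : ι) (x y : β), ReflTransGen R x y →
      ReflTransGen (fun f g : ι → β => ∀ i, R (f i) (g i)) (Function.update f i x)
        (Function.update f i y) := by
    intro f i x y hxy
    refine ReflTransGen.lift (Function.update f i) (fun x y hxy j => ?_) x y hxy
    rcases eq_or_ne j i with rfl | hj
    · simpa using hxy
    · simpa [hj] using hR (f j)
  have key : ∀ s : Finset ι,
      ReflTransGen (fun f g : ι → β => ∀ i, R (f i) (g i)) a (s.piecewise b a) := by
    intro s
    induction s using Finset.induction_on with
    | empty => simpa using ReflTransGen.refl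
    | insert i s hi ih =>
      refine ih.trans ?_
      -- As `i ∉ s`, the current tuple still has the value `a i` at `i`, so it is the start of this
      -- chain.
      have := step (s.piecewise b a) i (a i) (b i) (h i)
      rwa [← Finset.piecewise_insert, Function.update_eq_self_iff.2
        (Finset.piecewise_eq_of_notMem _ _ _ hi).symm] at this
  simpa using key Finset.univ

namespace DLf

lemma exists_factor {Y A Z : DLf.{u}} (p : Y ⟶ A) (hp : Function.Surjective p.hom)
    (q : Y ⟶ Z) (hq : ∀ a b, p.hom a ≤ p.hom b → q.hom a ≤ q.hom b) :
    ∃ h : A ⟶ Z, p ≫ h = q := by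
  obtain ⟨h, hh⟩ := BddDistLat.exists_factor p.hom hp q.hom hq
  exact ⟨isFiniteDL.homMk h, isFiniteDL.hom_ext hh⟩

lemma le_of_surjective_comp_le {Y A Z : DLf.{u}} (p : Y ⟶ A) (hp : Function.Surjective p.hom)
    {h h' : A ⟶ Z} (hh : p ≫ h ≤ p ≫ h') : h ≤ h' := by
  intro a
  obtain ⟨y, rfl⟩ := hp a
  exact hh y

/-- The coinserter cocone `c` is a surjection onto the quotient by the preorder generated by the
inequalities `d⁰ x ≤ d¹ x`. -/
structure IsStepQuotient {D : WalkingParallelPair ⥤ DLf.{u}} {L : DLf.{u}}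
    (c : (coinserterDiagramOf D).Cocone L) : Prop where
  surjective : Function.Surjective (coinserterLeg c).hom
  reflTransGen : ∀ a b, (coinserterLeg c).hom a ≤ (coinserterLeg c).hom b →
    ReflTransGen (CoinserterStep (D.map .left).hom (D.map .right).hom) a b

lemma map_le_of_reflTransGen {X Y Z : DLf.{u}} {d0 d1 : X ⟶ Y} {q : Y ⟶ Z}
    (hq : d0 ≫ q ≤ d1 ≫ q) {a b : Y.obj}
    (h : ReflTransGen (CoinserterStep d0.hom d1.hom) a b) : q.hom a ≤ q.hom b := by
  induction h with
  | refl => exact le_rfl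
  | tail _ hs ih =>
    obtain ⟨x, h0, h1⟩ := hs
    exact ih.trans ((hom_mono q.hom h0).trans ((hq x).trans (hom_mono q.hom h1)))

lemma IsStepQuotient.isColimit {D : WalkingParallelPair ⥤ DLf.{u}} {L : DLf.{u}}
    {c : (coinserterDiagramOf D).Cocone L} (hc : IsStepQuotient c) : c.IsColimit := by
  rw [isColimit_coinserter_iff]
  exact fun X => ⟨fun h h' hh => le_of_surjective_comp_le _ hc.surjective hh, fun q hq =>
    exists_factor _ hc.surjective q fun a b hab =>
      map_le_of_reflTransGen hq (hc.reflTransGen a b hab)⟩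

/-! ### The step relation of a reflexive pair -/

section Step

variable {X Y : DLf.{u}} {d0 d1 : X ⟶ Y}

lemma coinserterStep_refl (hi : ∃ i : Y ⟶ X, i ≫ d0 = 𝟙 Y ∧ i ≫ d1 = 𝟙 Y) (y : Y.obj) :
    CoinserterStep d0.hom d1.hom y y := by
  obtain ⟨i, h0, h1⟩ := hi
  have h0' : d0.hom (i.hom y) = y := congrArg (fun k : Y ⟶ Y => k.hom y) h0
  have h1' : d1.hom (i.hom y) = y := congrArg (fun k : Y ⟶ Y => k.hom y) h1
  exact ⟨i.hom y, h0'.ge, h1'.le⟩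

lemma coinserterStep_sup {a b a' b' : Y.obj} (h : CoinserterStep d0.hom d1.hom a b)
    (h' : CoinserterStep d0.hom d1.hom a' b') :
    CoinserterStep d0.hom d1.hom (a ⊔ a') (b ⊔ b') := by
  obtain ⟨x, h0, h1⟩ := h
  obtain ⟨x', h0', h1'⟩ := h'
  exact ⟨x ⊔ x', (sup_le_sup h0 h0').trans_eq (map_sup d0.hom.hom x x').symm,
    (map_sup d1.hom.hom x x').trans_le (sup_le_sup h1 h1')⟩

lemma coinserterStep_inf {a b a' b' : Y.obj} (h : CoinserterStep d0.hom d1.hom a b)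
    (h' : CoinserterStep d0.hom d1.hom a' b') :
    CoinserterStep d0.hom d1.hom (a ⊓ a') (b ⊓ b') := by
  obtain ⟨x, h0, h1⟩ := h
  obtain ⟨x', h0', h1'⟩ := h'
  exact ⟨x ⊓ x', (inf_le_inf h0 h0').trans_eq (map_inf d0.hom.hom x x').symm,
    (map_inf d1.hom.hom x x').trans_le (inf_le_inf h1 h1')⟩

/-- The coinserter of a reflexive pair of finite distributive lattices is the quotient by the
preorder generated by the inequalities `d⁰ x ≤ d¹ x`. -/
lemma exists_isStepQuotient (hi : ∃ i : Y ⟶ X, i ≫ d0 = 𝟙 Y ∧ i ≫ d1 = 𝟙 Y) :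
    ∃ (L : DLf.{u}) (c : (coinserterDiagramOf (parallelPair d0 d1)).Cocone L),
      IsStepQuotient c := by
  have hrefl := coinserterStep_refl hi
  obtain ⟨Q, p, hp, hpr⟩ := BddDistLat.exists_quotient Y.obj
    (ReflTransGen (CoinserterStep d0.hom d1.hom))
    (fun a b hab => by
      obtain ⟨x, h0, h1⟩ := hrefl b
      exact .single ⟨x, hab.trans h0, h1⟩)
    (fun a b c => ReflTransGen.trans)
    (fun a b c ha hb => by
      -- The two chains may differ in length, so they are run one after the other, with the idle
      -- argument held fixed by a reflexive step.
      have h1 : ReflTransGen _ (a ⊔ b) (c ⊔ b) := ReflTransGen.lift (· ⊔ b)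
        (fun x y h => coinserterStep_sup h (hrefl b)) _ _ ha
      have h2 : ReflTransGen _ (c ⊔ b) (c ⊔ c) := ReflTransGen.lift (c ⊔ ·)
        (fun x y h => coinserterStep_sup (hrefl c) h) _ _ hb
      simpa using h1.trans h2)
    (fun a b c ha hb => by
      have h1 : ReflTransGen _ (c ⊓ c) (a ⊓ c) := ReflTransGen.lift (· ⊓ c)
        (fun x y h => coinserterStep_inf h (hrefl c)) _ _ ha
      have h2 : ReflTransGen _ (a ⊓ c) (a ⊓ b) := ReflTransGen.lift (a ⊓ ·)
        (fun x y h => coinserterStep_inf (hrefl a) h) _ _ hb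
      simpa using h1.trans h2)
  have : Finite Y.obj := Y.property
  let L : DLf.{u} := ⟨Q, Finite.of_surjective p hp⟩
  let q : Y ⟶ L := isFiniteDL.homMk p
  have hq : d0 ≫ q ≤ d1 ≫ q := fun x => (hpr _ _).2 (.single ⟨x, le_rfl, le_rfl⟩)
  exact ⟨L, coinserterCocone (D := parallelPair d0 d1) q hq, hp, fun a b => (hpr a b).1⟩

/-- Comparison with the explicit quotient: surjectivity and the kernel preorder transfer along the
comparison maps `h` and `k`, and only `h ≫ k = 𝟙 L` is needed. -/
lemma isStepQuotient_of_isColimit (hi : ∃ i : Y ⟶ X, i ≫ d0 = 𝟙 Y ∧ i ≫ d1 = 𝟙 Y)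
    {L : DLf.{u}} {c : (coinserterDiagramOf (parallelPair d0 d1)).Cocone L} (hc : c.IsColimit) :
    IsStepQuotient c := by
  obtain ⟨L', c', hc'⟩ := exists_isStepQuotient hi
  have hu := (isColimit_coinserter_iff c).1 hc
  obtain ⟨h, hh⟩ := (hu L').2 (coinserterLeg c') (coinserterLeg_condition c')
  obtain ⟨k, hk⟩ := ((isColimit_coinserter_iff c').1 hc'.isColimit L).2 (coinserterLeg c)
    (coinserterLeg_condition c)
  have hid : coinserterLeg c ≫ h ≫ k = coinserterLeg c ≫ 𝟙 L := by
    rw [reassoc_of% hh, hk, Category.comp_id]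
  have hhk : h ≫ k = 𝟙 L := le_antisymm ((hu L).1 _ _ hid.le) ((hu L).1 _ _ hid.ge)
  constructor
  · intro l
    obtain ⟨y, hy⟩ := hc'.surjective (h.hom l)
    refine ⟨y, ?_⟩
    rw [← hk]
    exact (congrArg k.hom hy).trans (congrArg (fun f : L ⟶ L => f.hom l) hhk)
  · intro a b hab
    refine hc'.reflTransGen a b ?_
    rw [← hh]
    exact hom_mono h.hom hab

end Step

/-- Freeness of `F` turns maps into tuples, so the poset criterion `isColimit_coinserter_partOrd`
can be checked on generators. -/
lemma isAbsolute_reflexiveCoinserter (p : ReflexivePair DLf.{u}) :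
    IsAbsolute inclDLff.{u} (reflexiveCoinserters DLf.{u} p) := by
  obtain ⟨d0, d1, hi⟩ := p
  rename_i X Y
  intro F L c hc
  obtain ⟨n, η, hη⟩ := F.property
  have hη : IsFree η := hη
  have hq := isStepQuotient_of_isColimit hi hc
  refine isColimit_coinserter_partOrd
    (D := parallelPair d0 d1 ⋙ homFrom (inclDLff.{u}.obj F)) (c.map (homFrom _)) ?_ ?_
  · intro g
    choose y hy using fun i => hq.surjective (g.hom (η i))
    refine ⟨isFiniteDL.homMk (hη.lift y), isFiniteDL.hom_ext (hη.hom_ext fun i => ?_)⟩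
    exact (congrArg (coinserterLeg c).hom (hη.lift_apply y i)).trans (hy i)
  · intro a b hab
    have hpi := reflTransGen_pi (coinserterStep_refl hi) fun i =>
      hq.reflTransGen (a.hom (η i)) (b.hom (η i)) (hab (η i))
    have hlift : ∀ g : inclDLff.{u}.obj F ⟶ Y,
        isFiniteDL.homMk (hη.lift fun i => g.hom (η i)) = g := fun g =>
      isFiniteDL.hom_ext (hη.hom_ext fun i => hη.lift_apply _ i)
    rw [← hlift a, ← hlift b]
    refine ReflTransGen.lift
      (fun y : Fin n → Y.obj => (isFiniteDL.homMk (hη.lift y) : inclDLff.{u}.obj F ⟶ Y)) ?_ _ _ hpi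
    intro y y' hyy'
    -- The witnesses of the coordinate steps form a tuple in `X`; its lift witnesses a step between
    -- homs.
    choose x hx0 hx1 using hyy'
    refine ⟨(isFiniteDL.homMk (hη.lift x) : inclDLff.{u}.obj F ⟶ X), hη.le_of_le fun i => ?_,
      hη.le_of_le fun i => ?_⟩
    · exact (hη.lift_apply y i).trans_le
        ((hx0 i).trans_eq (congrArg d0.hom (hη.lift_apply x i).symm))
    · exact (congrArg d1.hom (hη.lift_apply x i)).trans_le
        ((hx1 i).trans_eq (hη.lift_apply y' i).symm)

/-! ### Presentations by free lattices -/

/-- The free bounded distributive lattice on a finite set, as an object of `DL_ff`. -/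
abbrev freeObj (ι : Type u) [Finite ι] : DLff.{u} :=
  ⟨free ι, isDiscretelyFinitelyFree_free⟩

/-- The homomorphism out of a free lattice which is determined by its values on the generators. -/
noncomputable def freeLift {ι : Type u} [Finite ι] {A : DLf.{u}} (f : ι → A.obj) :
    inclDLff.obj (freeObj ι) ⟶ A :=
  isFiniteDL.homMk (isFree_freeGen.lift f)

lemma freeLift_freeGen {ι : Type u} [Finite ι] {A : DLf.{u}} (f : ι → A.obj) (i : ι) :
    (freeLift f).hom (freeGen i) = f i :=
  isFree_freeGen.lift_apply f i

lemma free_hom_ext {ι : Type u} [Finite ι] {A : DLf.{u}} {f g : inclDLff.obj (freeObj ι) ⟶ A}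
    (h : ∀ i, f.hom (freeGen i) = g.hom (freeGen i)) : f = g :=
  isFiniteDL.hom_ext (isFree_freeGen.hom_ext h)

lemma free_hom_le {ι : Type u} [Finite ι] {A : DLf.{u}} {f g : inclDLff.obj (freeObj ι) ⟶ A}
    (h : ∀ i, f.hom (freeGen i) ≤ g.hom (freeGen i)) : f ≤ g :=
  isFree_freeGen.le_of_le h

instance (A : DLf.{u}) : Finite A.obj :=
  A.property

/-- The canonical homomorphism onto `A` from the free lattice on its elements. -/
noncomputable def counit (A : DLf.{u}) : inclDLff.obj (freeObj A.obj) ⟶ A :=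
  freeLift id

lemma counit_surjective (A : DLf.{u}) : Function.Surjective (counit A).hom := fun a =>
  ⟨freeGen a, freeLift_freeGen id a⟩

lemma colimitClosure (A : DLf.{u}) :
    ColimitClosure inclDLff.{u} (reflexiveCoinserters DLf.{u}) A := by
  have : Finite (inclDLff.{u}.obj (freeObj A.obj)).obj :=
    (inclDLff.{u}.obj (freeObj A.obj)).property
  -- The full kernel preorder is used as the set of relations, so that one step already realises
  -- each inequality.
  let R := {p : free A.obj × free A.obj // (counit A).hom p.1 ≤ (counit A).hom p.2}
  have : Finite R := Subtype.finite
  let d0 : inclDLff.obj (freeObj R) ⟶ inclDLff.obj (freeObj A.obj) := freeLift fun p => p.1.1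
  let d1 : inclDLff.obj (freeObj R) ⟶ inclDLff.obj (freeObj A.obj) := freeLift fun p => p.1.2
  -- The common section sends a generator to the generator indexed by its diagonal pair.
  let i : inclDLff.obj (freeObj A.obj) ⟶ inclDLff.obj (freeObj R) :=
    freeLift fun a => freeGen ⟨(freeGen a, freeGen a), le_rfl⟩
  have hd0 : ∀ p : R, d0.hom (freeGen p) = p.1.1 := freeLift_freeGen _
  have hd1 : ∀ p : R, d1.hom (freeGen p) = p.1.2 := freeLift_freeGen _
  have h0 : i ≫ d0 = 𝟙 _ := free_hom_ext fun a =>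
    (congrArg d0.hom (freeLift_freeGen _ a)).trans (hd0 _)
  have h1 : i ≫ d1 = 𝟙 _ := free_hom_ext fun a =>
    (congrArg d1.hom (freeLift_freeGen _ a)).trans (hd1 _)
  have hd : d0 ≫ counit A ≤ d1 ≫ counit A := free_hom_le fun p =>
    (congrArg (counit A).hom (hd0 p)).trans_le
      (p.2.trans_eq (congrArg (counit A).hom (hd1 p)).symm)
  have hc : IsStepQuotient (coinserterCocone (D := parallelPair d0 d1) (counit A) hd) :=
    ⟨counit_surjective A, fun a b hab =>
      .single ⟨freeGen ⟨(a, b), hab⟩, (hd0 ⟨(a, b), hab⟩).ge,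
        (hd1 ⟨(a, b), hab⟩).le⟩⟩
  refine .of_isColimit ⟨d0, d1, i, h0, h1⟩ A _ hc.isColimit fun d => ?_
  cases d with
  | zero => exact .of (freeObj R)
  | one => exact .of (freeObj A.obj)

lemma isDense : IsDense inclDLff.{u} := by
  intro A
  rw [WeightedDiagram.Cocone.isColimit_iff]
  refine fun X => ⟨fun h h' hh => ?_, fun α => ?_⟩
  · exact le_of_surjective_comp_le (counit A) (counit_surjective A)
      (hh (op (freeObj A.obj)) (counit A))
  · let app (G : DLff.{u}) (g : inclDLff.obj G ⟶ A) : inclDLff.obj G ⟶ X := (α.app (op G)).hom g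
    have app_comp : ∀ {G G' : DLff.{u}} (k : G ⟶ G') (g : inclDLff.obj G' ⟶ A),
        app G (inclDLff.map k ≫ g) = inclDLff.map k ≫ app G' g := fun {G G'} k g =>
      congrArg (fun f : PartOrd.of (inclDLff.obj G' ⟶ A) ⟶ PartOrd.of (inclDLff.obj G ⟶ X) =>
        f.hom g) (α.naturality k.op)
    have app_mono : ∀ (G : DLff.{u}) {g g' : inclDLff.obj G ⟶ A}, g ≤ g' → app G g ≤ app G g' :=
      fun G _ _ h => (α.app (op G)).hom.monotone h
    let q := app (freeObj A.obj) (counit A)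
    have hq : ∀ a b, (counit A).hom a ≤ (counit A).hom b → q.hom a ≤ q.hom b := by
      -- Elements of the free lattice are maps from the free lattice on one generator; the
      -- inequality becomes one between homs, to which monotonicity and naturality of `α` apply.
      intro a b hab
      let pt (y : free A.obj) : freeObj PUnit.{u + 1} ⟶ freeObj A.obj :=
        isDiscretelyFinitelyFree.homMk (isFree_freeGen.lift fun _ => y)
      have hpt : ∀ y, (pt y).hom (freeGen PUnit.unit) = y := fun y =>
        isFree_freeGen.lift_apply (fun _ => y) PUnit.unit
      have hle : inclDLff.map (pt a) ≫ counit A ≤ inclDLff.map (pt b) ≫ counit A :=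
        free_hom_le fun _ => (congrArg (counit A).hom (hpt a)).trans_le
          (hab.trans_eq (congrArg (counit A).hom (hpt b)).symm)
      have := app_mono _ hle
      rw [app_comp, app_comp] at this
      exact (congrArg q.hom (hpt a)).symm.trans_le
        ((this (freeGen PUnit.unit)).trans_eq (congrArg q.hom (hpt b)))
    obtain ⟨h, hh⟩ := exists_factor (counit A) (counit_surjective A) q hq
    refine ⟨h, ?_⟩
    ext ⟨G⟩ g
    change inclDLff.obj G ⟶ A at g
    change g ≫ h = app G g
    obtain ⟨n, η, hη⟩ := G.property
    have hη : IsFree η := hη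
    -- Freeness of `G` factors `g` through `counit A`, and naturality of `α` along `k` then fixes
    -- its value at `g`.
    let k : G ⟶ freeObj A.obj :=
      isDiscretelyFinitelyFree.homMk (hη.lift fun i => freeGen (g.hom (η i)))
    have hk : inclDLff.map k ≫ counit A = g := isFiniteDL.hom_ext (hη.hom_ext fun i =>
      (congrArg (counit A).hom (hη.lift_apply _ i)).trans (freeLift_freeGen id _))
    rw [← hk, app_comp, Category.assoc, hh]

end DLf

theorem theorem5p7 :
    IsDense inclDLff.{u} ∧
      IsDensityPresentation inclDLff.{u} (reflexiveCoinserters DLf.{u}) := by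
  refine ⟨DLf.isDense, ?_, fun p => ?_, DLf.isAbsolute_reflexiveCoinserter, DLf.colimitClosure⟩
  · refine fun a b => ⟨⟨⟨fun f => inclDLff.map f,
      fun f => isDiscretelyFinitelyFree.homMk f.hom, fun f => rfl, fun f => rfl⟩, Iff.rfl⟩,
      fun f => rfl⟩
  · obtain ⟨L, c, hc⟩ := DLf.exists_isStepQuotient p.exists_section
    exact ⟨L, c, hc.isColimit⟩
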